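/- For complex numbers (in particular, real numbers) $a,b,c$ with $c \notin \{0,-1,-2,\dots\}$ and for $|z|<1$, let $$F(a,b;c;z) = {}_2F_1(a,b;c;z) = \sum_{n=0}^{\infty} \frac{(a)_n (b)_n}{(c)_n}\,\frac{z^n}{n!}, \qquad (a)_n = a(a+1)\cdots(a+n-1),\quad (a)_0 = 1,$$ denote the Gauss hypergeometric function. If $x$ is a real number with $0 < x < 1$, then $$\sqrt{1+3x}\; F\Big(\frac14,\frac34;1;x^2\Big) = F\Big(\frac14,\frac34;1;\,1-\Big(\frac{1-x}{1+3x}\Big)^2\Big).$$ -/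

import Mathlib

/-! Both u(x) = F(x²) and v(x) = F(φ(x))/√(1+3x), with φ the argument on the right-hand side, solve
one linear equation (p y')' = q y with p = x(1 - x²). Hence p(uv' - u'v) is constant on [0, 1). It
vanishes at 0, where p does and both functions are smooth, so v/u is constant; its value at 0 is 1.
The equation for F comes from its power series, and u > 0 from the positivity of the coefficients.
-/

open FormalMultilinearSeries in
theorem HasFPowerSeriesOnBall.deriv_ofScalars {f : ℝ → ℝ} {c : ℕ → ℝ} {r : ENNReal}
    (h : HasFPowerSeriesOnBall f (ofScalars ℝ c) 0 r) :
    HasFPowerSeriesOnBall (deriv f) (ofScalars ℝ fun n => (n + 1) * c (n + 1)) 0 r := by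
  convert! (ContinuousLinearMap.apply ℝ ℝ (1 : ℝ)).comp_hasFPowerSeriesOnBall h.fderiv
  ext n
  simp

theorem HasFPowerSeriesOnBall.hasSum_ofScalars {f : ℝ → ℝ} {c : ℕ → ℝ}
    (h : HasFPowerSeriesOnBall f (FormalMultilinearSeries.ofScalars ℝ c) 0 1) {t : ℝ}
    (ht : |t| < 1) : HasSum (fun n => c n * t ^ n) (f t) := by
  have := h.hasSum (y := t) (by simpa [enorm_eq_nnnorm, ← NNReal.coe_lt_coe] using ht)
  simpa [FormalMultilinearSeries.ofScalars_apply_eq, mul_comm] using this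

theorem HasSum.mul_pow_shift {d e : ℕ → ℝ} {t s : ℝ} (h : HasSum (fun n => d n * t ^ n) s)
    (he₀ : e 0 = 0) (he : ∀ n, e (n + 1) = d n) : HasSum (fun n => e n * t ^ n) (t * s) := by
  rw [← hasSum_nat_add_iff' 1]
  convert! h.mul_left t using 1
  · ext n
    rw [he]
    ring
  · simp [he₀]

section

variable {a b c : ℝ}

theorem ordinaryHypergeometricCoefficient_succ (hc : ∀ k : ℕ, (k : ℝ) ≠ -c) (n : ℕ) :
    (n + 1) * (c + n) * ordinaryHypergeometricCoefficient a b c (n + 1) =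
      (a + n) * (b + n) * ordinaryHypergeometricCoefficient a b c n := by
  have h1 : c + n ≠ 0 := fun h => hc n (by linarith)
  have h2 : (ascPochhammer ℝ n).eval c ≠ 0 := by
    rw [Ne, ascPochhammer_eval_eq_zero_iff]
    rintro ⟨k, -, hk⟩
    exact hc k hk
  have h3 : (n.factorial : ℝ) ≠ 0 := by positivity
  simp only [ordinaryHypergeometricCoefficient, ascPochhammer_succ_eval, Nat.factorial_succ,
    Nat.cast_mul, Nat.cast_succ]
  field_simp

theorem hasFPowerSeriesOnBall_ordinaryHypergeometric
    (habc : ∀ k : ℕ, (k : ℝ) ≠ -a ∧ (k : ℝ) ≠ -b ∧ (k : ℝ) ≠ -c) :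
    HasFPowerSeriesOnBall (₂F₁ a b c : ℝ → ℝ)
      (FormalMultilinearSeries.ofScalars ℝ (ordinaryHypergeometricCoefficient a b c)) 0 1 := by
  have h := ordinaryHypergeometricSeries_radius_eq_one ℝ a b c habc
  rw [← h]
  exact FormalMultilinearSeries.hasFPowerSeriesOnBall _ (by rw [h]; exact one_pos)

/-- The Gauss hypergeometric function solves the hypergeometric differential equation. -/
theorem ordinaryHypergeometric_ode
    (habc : ∀ k : ℕ, (k : ℝ) ≠ -a ∧ (k : ℝ) ≠ -b ∧ (k : ℝ) ≠ -c) {t : ℝ} (ht : |t| < 1) :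
    t * (1 - t) * deriv (deriv (₂F₁ a b c)) t + (c - (a + b + 1) * t) * deriv (₂F₁ a b c) t =
      a * b * ₂F₁ a b c t := by
  have p0 := hasFPowerSeriesOnBall_ordinaryHypergeometric habc
  have p1 := p0.deriv_ofScalars
  have h0 := p0.hasSum_ofScalars ht
  have h1 := p1.hasSum_ofScalars ht
  have h2 := p1.deriv_ofScalars.hasSum_ofScalars ht
  set A := ordinaryHypergeometricCoefficient a b c
  have h1' : HasSum (fun n : ℕ => (n * A n) * t ^ n) _ := h1.mul_pow_shift (by simp) (by simp)
  have h2' : HasSum (fun n : ℕ => (n * ((n + 1) * A (n + 1))) * t ^ n) _ :=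
    h2.mul_pow_shift (by simp) (by simp)
  have h2'' : HasSum (fun n : ℕ => (n * (n - 1) * A n) * t ^ n) _ :=
    h2'.mul_pow_shift (by simp) (fun n => by push_cast; ring)
  have L := h2'.add (h1.mul_left c)
  have R := (h2''.add (h1'.mul_left (a + b + 1))).add (h0.mul_left (a * b))
  -- Coefficients of tⁿ agree by the recurrence, as n(n-1) + (a+b+1)n + ab = (a+n)(b+n).
  have key := L.unique (R.congr_fun fun n => ?_)
  · linear_combination key
  · have := ordinaryHypergeometricCoefficient_succ (a := a) (b := b) (fun k => (habc k).2.2) n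
    linear_combination t ^ n * this

theorem ordinaryHypergeometric_pos
    (ha : 0 < a) (hb : 0 < b) (hc : 0 < c) {t : ℝ} (ht : 0 ≤ t) (ht' : t < 1) :
    0 < ₂F₁ a b c t := by
  have habc : ∀ k : ℕ, (k : ℝ) ≠ -a ∧ (k : ℝ) ≠ -b ∧ (k : ℝ) ≠ -c := fun k => by
    have := Nat.cast_nonneg (α := ℝ) k
    refine ⟨?_, ?_, ?_⟩ <;> intro h <;> linarith
  have h := (hasFPowerSeriesOnBall_ordinaryHypergeometric habc).hasSum_ofScalars
    (abs_lt.2 ⟨by linarith, ht'⟩)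
  rw [← h.tsum_eq]
  refine h.summable.tsum_pos (fun n => ?_) 0 (by simp)
  have h1 := ascPochhammer_pos n a ha
  have h2 := ascPochhammer_pos n b hb
  have h3 := ascPochhammer_pos n c hc
  positivity

end

/-- A continuous function on `[x, y]` with zero derivative inside has equal end values. -/
theorem eq_of_hasDerivAt_zero_Ioo {f : ℝ → ℝ} {x y : ℝ} (hxy : x < y)
    (hf : ContinuousOn f (Set.Icc x y)) (hf' : ∀ z ∈ Set.Ioo x y, HasDerivAt f 0 z) :
    f y = f x := by
  obtain ⟨z, -, hz⟩ := exists_hasDerivAt_eq_slope f (fun _ => 0) hxy hf hf'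
  rw [eq_comm, div_eq_zero_iff] at hz
  rcases hz with hz | hz <;> linarith

namespace QuarticTransformation

/-- The hypergeometric function `₂F₁(1/4, 3/4; 1; t)`. -/
noncomputable def F (t : ℝ) : ℝ := ₂F₁ (1 / 4 : ℝ) (3 / 4 : ℝ) (1 : ℝ) t

/-- The flux `t (1 - t) F'(t)` in the self-adjoint form of the hypergeometric equation. -/
noncomputable def flux (t : ℝ) : ℝ := t * (1 - t) * deriv F t

theorem natCast_ne_neg (k : ℕ) :
    (k : ℝ) ≠ -(1 / 4) ∧ (k : ℝ) ≠ -(3 / 4) ∧ (k : ℝ) ≠ -1 := by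
  have := Nat.cast_nonneg (α := ℝ) k
  refine ⟨?_, ?_, ?_⟩ <;> intro h <;> linarith

theorem F_pos {t : ℝ} (ht : 0 ≤ t) (ht' : t < 1) : 0 < F t :=
  ordinaryHypergeometric_pos (by norm_num) (by norm_num) (by norm_num) ht ht'

theorem F_zero : F 0 = 1 := ordinaryHypergeometric_zero _ _ _

theorem mem_eball_of_abs_lt_one {t : ℝ} (ht : |t| < 1) : t ∈ Metric.eball (0 : ℝ) 1 := by
  simpa [enorm_eq_nnnorm, ← NNReal.coe_lt_coe] using ht

theorem hasDerivAt_F {t : ℝ} (ht : |t| < 1) : HasDerivAt F (deriv F t) t :=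
  ((hasFPowerSeriesOnBall_ordinaryHypergeometric natCast_ne_neg).analyticAt_of_mem
    (mem_eball_of_abs_lt_one ht)).differentiableAt.hasDerivAt

/-- Since c = a + b = 1, the first-order coefficient 1 - 2t is the derivative of t(1 - t). -/
theorem hasDerivAt_flux {t : ℝ} (ht : |t| < 1) : HasDerivAt flux (3 / 16 * F t) t := by
  have h2 : HasDerivAt (deriv F) (deriv (deriv F) t) t :=
    ((hasFPowerSeriesOnBall_ordinaryHypergeometric natCast_ne_neg).deriv_ofScalars.analyticAt_of_mem
      (mem_eball_of_abs_lt_one ht)).differentiableAt.hasDerivAt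
  have ode := ordinaryHypergeometric_ode natCast_ne_neg ht
  change t * (1 - t) * deriv (deriv F) t + _ * deriv F t = _ * F t at ode
  convert! ((hasDerivAt_id t).mul ((hasDerivAt_id t).const_sub 1)).mul h2 using 1
  simp only [id, Pi.mul_apply]
  linear_combination -ode

/-- The change of variable in the transformation formula. -/
noncomputable def phi (x : ℝ) : ℝ := 1 - ((1 - x) / (1 + 3 * x)) ^ 2

theorem phi_eq {x : ℝ} (hx : 0 ≤ x) :
    phi x = 8 * x * (1 + x) / (1 + 3 * x) ^ 2 := by
  unfold phi
  field_simp
  ring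

theorem phi_nonneg {x : ℝ} (hx : 0 ≤ x) (hx' : x < 1) : 0 ≤ phi x := by
  have h : (1 - x) / (1 + 3 * x) ≤ 1 := by rw [div_le_one (by linarith)]; linarith
  have h0 : 0 ≤ (1 - x) / (1 + 3 * x) := div_nonneg (by linarith) (by linarith)
  unfold phi
  nlinarith

theorem phi_lt_one {x : ℝ} (hx : 0 ≤ x) (hx' : x < 1) : phi x < 1 := by
  have h0 : 0 < (1 - x) / (1 + 3 * x) := div_pos (by linarith) (by linarith)
  unfold phi
  nlinarith

theorem abs_phi_lt_one {x : ℝ} (hx : 0 ≤ x) (hx' : x < 1) : |phi x| < 1 :=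
  abs_lt.2 ⟨by linarith [phi_nonneg hx hx'], phi_lt_one hx hx'⟩

theorem abs_sq_lt_one {x : ℝ} (hx : 0 ≤ x) (hx' : x < 1) : |x ^ 2| < 1 := by
  rw [abs_of_nonneg (by positivity)]
  nlinarith

theorem hasDerivAt_phi {x : ℝ} (hx : 0 ≤ x) :
    HasDerivAt phi (8 * (1 - x) / (1 + 3 * x) ^ 3) x := by
  have hq : 1 + 3 * x ≠ 0 := by positivity
  convert! (((((hasDerivAt_id x).const_sub 1).div
    (((hasDerivAt_id x).const_mul 3).const_add 1) hq).pow 2).const_sub 1) using 1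
  simp only [id, Pi.div_apply, Nat.add_one_sub_one, pow_one]
  push_cast
  field_simp
  ring

theorem hasDerivAt_sqrt_one_add {x : ℝ} (hx : 0 ≤ x) :
    HasDerivAt (fun x => √(1 + 3 * x)) (3 / (2 * √(1 + 3 * x))) x := by
  have hq : 1 + 3 * x ≠ 0 := by positivity
  simpa using (((hasDerivAt_id x).const_mul 3).const_add 1).sqrt hq

theorem hasDerivAt_F_sq {x : ℝ} (hx : 0 ≤ x) (hx' : x < 1) :
    HasDerivAt (fun x => F (x ^ 2)) (deriv F (x ^ 2) * (2 * x)) x := by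
  simpa using! HasDerivAt.comp (h₂ := F) (h := fun x => x ^ 2) x (hasDerivAt_F (abs_sq_lt_one hx hx'))
     (hasDerivAt_pow 2 x)

theorem hasDerivAt_flux_sq {x : ℝ} (hx : 0 ≤ x) (hx' : x < 1) :
    HasDerivAt (fun x => flux (x ^ 2)) (3 / 16 * F (x ^ 2) * (2 * x)) x := by
  simpa using! HasDerivAt.comp (h₂ := flux) (h := fun x => x ^ 2) x
    (hasDerivAt_flux (abs_sq_lt_one hx hx')) (hasDerivAt_pow 2 x)

theorem hasDerivAt_F_phi {x : ℝ} (hx : 0 ≤ x) (hx' : x < 1) :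
    HasDerivAt (fun x => F (phi x)) (deriv F (phi x) * (8 * (1 - x) / (1 + 3 * x) ^ 3)) x :=
  (hasDerivAt_F (abs_phi_lt_one hx hx')).comp x (hasDerivAt_phi hx)

theorem hasDerivAt_flux_phi {x : ℝ} (hx : 0 ≤ x) (hx' : x < 1) :
    HasDerivAt (fun x => flux (phi x))
      (3 / 16 * F (phi x) * (8 * (1 - x) / (1 + 3 * x) ^ 3)) x :=
  (hasDerivAt_flux (abs_phi_lt_one hx hx')).comp x (hasDerivAt_phi hx)

/-- The normalised Wronskian `x (1 - x ^ 2) (u v' - u' v)` of `u x = F (x ^ 2)` and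
`v x = F (phi x) / √(1 + 3 x)`. -/
noncomputable def wronskian (x : ℝ) : ℝ :=
  F (x ^ 2) * (√(1 + 3 * x) * flux (phi x)
    - 3 / 2 * (x * (1 - x ^ 2)) * F (phi x) / √(1 + 3 * x) ^ 3)
    - 2 * flux (x ^ 2) * F (phi x) / √(1 + 3 * x)

theorem hasDerivAt_wronskian {x : ℝ} (hx : 0 ≤ x) (hx' : x < 1) :
    HasDerivAt wronskian 0 x := by
  have hq : 0 < 1 + 3 * x := by positivity
  have hs : 0 < √(1 + 3 * x) := Real.sqrt_pos.2 hq
  have hS := hasDerivAt_sqrt_one_add hx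
  have hU := hasDerivAt_F_sq hx hx'
  have hK := hasDerivAt_flux_sq hx hx'
  have hV := hasDerivAt_F_phi hx hx'
  have hL := hasDerivAt_flux_phi hx hx'
  have hP : HasDerivAt (fun x : ℝ => 3 / 2 * (x * (1 - x ^ 2))) (3 / 2 * (1 - 3 * x ^ 2)) x := by
    convert! ((hasDerivAt_id x).mul ((hasDerivAt_pow 2 x).const_sub 1)).const_mul (3 / 2) using 1
    simp only [id]
    push_cast
    ring
  convert! (hU.mul ((hS.mul hL).sub ((hP.mul hV).div (hS.pow 3) (pow_ne_zero 3 hs.ne')))).sub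
    (((hK.const_mul 2).mul hV).div hS hs.ne') using 1
  simp only [Pi.mul_apply, Pi.div_apply, Pi.sub_apply, Pi.pow_apply, flux]
  generalize F (phi x) = V at *
  generalize deriv F (phi x) = V' at *
  generalize F (x ^ 2) = U at *
  generalize deriv F (x ^ 2) = U' at *
  rw [phi_eq hx]
  have hsq : √(1 + 3 * x) ^ 2 = 1 + 3 * x := Real.sq_sqrt hq.le
  generalize √(1 + 3 * x) = s at *
  rw [← hsq]
  -- Taking s = √(1+3x) as the variable leaves a rational identity in s and the values of F and F'.
  obtain rfl : x = (s ^ 2 - 1) / 3 := by linarith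
  field_simp
  ring

theorem wronskian_eq_zero {x : ℝ} (hx : 0 < x) (hx' : x < 1) : wronskian x = 0 := by
  rw [eq_of_hasDerivAt_zero_Ioo hx
    (fun z hz => (hasDerivAt_wronskian hz.1 (hz.2.trans_lt hx')).continuousAt.continuousWithinAt)
    (fun z hz => hasDerivAt_wronskian hz.1.le (hz.2.trans hx'))]
  simp [wronskian, flux, phi]

/-- The quotient of the two sides of the transformation formula. -/
noncomputable def quotient (x : ℝ) : ℝ := F (phi x) / (√(1 + 3 * x) * F (x ^ 2))

/-- At x = 0 only continuity is needed; the vanishing requires division by x(1 - x²). -/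
theorem hasDerivAt_quotient {x : ℝ} (hx : 0 ≤ x) (hx' : x < 1) :
    ∃ d, HasDerivAt quotient d x ∧ (0 < x → d = 0) := by
  have hq : 0 < 1 + 3 * x := by positivity
  have hs : 0 < √(1 + 3 * x) := Real.sqrt_pos.2 hq
  have hpos : 0 < F (x ^ 2) := F_pos (sq_nonneg x) (abs_lt.1 (abs_sq_lt_one hx hx')).2
  refine ⟨_, (hasDerivAt_F_phi hx hx').div
    ((hasDerivAt_sqrt_one_add hx).mul (hasDerivAt_F_sq hx hx')) (mul_pos hs hpos).ne', fun h0 => ?_⟩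
  have hw := wronskian_eq_zero h0 hx'
  simp only [wronskian, flux] at hw
  rw [div_eq_zero_iff]
  left
  have hx2 : 0 < x * (1 - x ^ 2) := mul_pos h0 (by nlinarith)
  generalize F (phi x) = V at *
  generalize deriv F (phi x) = V' at *
  generalize F (x ^ 2) = U at *
  generalize deriv F (x ^ 2) = U' at *
  rw [phi_eq hx] at hw
  have hsq : √(1 + 3 * x) ^ 2 = 1 + 3 * x := Real.sq_sqrt hq.le
  generalize √(1 + 3 * x) = s at *
  -- Times x(1 - x²), the numerator of the derivative is s² times the Wronskian.
  refine (mul_eq_zero.1 (?_ : x * (1 - x ^ 2) * _ = 0)).resolve_left hx2.ne'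
  rw [← mul_zero (s ^ 2), ← hw, ← hsq]
  obtain rfl : x = (s ^ 2 - 1) / 3 := by linarith
  field_simp
  ring

theorem quotient_eq_one {x : ℝ} (hx : 0 < x) (hx' : x < 1) : quotient x = 1 := by
  rw [eq_of_hasDerivAt_zero_Ioo (f := quotient) hx (fun z hz => ?_) (fun z hz => ?_)]
  · simp [quotient, phi, F_zero]
  · obtain ⟨d, hd, -⟩ := hasDerivAt_quotient hz.1 (hz.2.trans_lt hx')
    exact hd.continuousAt.continuousWithinAt
  · obtain ⟨d, hd, h⟩ := hasDerivAt_quotient hz.1.le (hz.2.trans hx')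
    rwa [h hz.1] at hd

end QuarticTransformation

open QuarticTransformation in
theorem mainTheorem1 (x : ℝ) (hx0 : 0 < x) (hx1 : x < 1) :
    Real.sqrt (1 + 3 * x) * ₂F₁ (1 / 4 : ℝ) (3 / 4 : ℝ) (1 : ℝ) (x ^ 2) =
      ₂F₁ (1 / 4 : ℝ) (3 / 4 : ℝ) (1 : ℝ) (1 - ((1 - x) / (1 + 3 * x)) ^ 2) := by
  have hs : 0 < √(1 + 3 * x) := Real.sqrt_pos.2 (by positivity)
  have hpos : 0 < F (x ^ 2) := F_pos (sq_nonneg x) (abs_lt.1 (abs_sq_lt_one hx0.le hx1)).2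
  exact ((div_eq_one_iff_eq (mul_pos hs hpos).ne').1 (quotient_eq_one hx0 hx1)).symm
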